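/- Let $n\ge 1$ and write $a_+=\max(a,0)$. There is a function $C=C(n,\cdot,\cdot)$ such that the following holds for every Lipschitz continuous $f:[0,1]^n\to(0,\infty)$. Let $w$ be the maximal (pointwise greatest) bounded viscosity solution of $$\prod_{i=1}^n (w+n x_i w_{x_i})_+ = f\quad\text{on }(0,1]^n ,$$ where no boundary condition is imposed, and where the $C^1$ test functions touch $w$ from above or below locally relative to $(0,1]^n$, points with some $x_i=1$ included. Then $w$ has a (unique) continuous extension to $[0,1]^n$, still denoted by $w$. For $h>0$ let $[0,1]^n_h=[0,1]^n\cap(h\mathbb Z)^n$, and let $w_h:[0,1]^n_h\to[0,\infty)$ be the maximal solution of the scheme $$\prod_{i=1}^n\bigl(w_h(x)+n x_i D_i^- w_h(x)\bigr)_+=f(x)\quad\text{for all }x\in[0,1]^n_h,\qquad D_i^-w_h(x)=\frac{w_h(x)-w_h(x-he_i)}{h},$$ that is, at each grid point $x$ the value $w_h(x)$ is the largest solution $t \ge 0$ of the equation obtained by putting $t$ in place of $w_h(x)$, given the values $w_h(x-he_i)$ (when $x_i=0$ the term $n x_iD_i^-w_h(x)$ is read as $0$). Then, for every $h>0$, $$|w(x)-w_h(x)|\le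 C\,\sqrt h\qquad\text{for all }x\in[0,1]^n_h ,$$ where $C=C\bigl(n,[f]_1,\inf_{[0,1]^n}f\bigr)$ and $[f]_1=\sup_{x\ne y\in[0,1]^n}|f(x)-f(y)|/|x-y|$ with the Euclidean norm $|\cdot|$. -/

import Mathlib

/-- The closed cube `[0,1]^n`, in Euclidean space. -/
def closedCube (n : ℕ) : Set (EuclideanSpace ℝ (Fin n)) :=
  {x | ∀ i, x i ∈ Set.Icc (0 : ℝ) 1}

/-- The half-open cube `(0,1]^n`. -/
def halfOpenCube (n : ℕ) : Set (EuclideanSpace ℝ (Fin n)) :=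
  {x | ∀ i, x i ∈ Set.Ioc (0 : ℝ) 1}

/-- The grid `[0,1]^n ∩ (hℤ)^n`. -/
def cubeGrid (n : ℕ) (h : ℝ) : Set (EuclideanSpace ℝ (Fin n)) :=
  {x | x ∈ closedCube n ∧ ∀ i, ∃ k : ℤ, x i = h * k}

/-- The Lipschitz seminorm `[f]_1` of `f` on the closed cube, with respect to the Euclidean norm. -/
noncomputable def lipSeminorm {n : ℕ} (f : EuclideanSpace ℝ (Fin n) → ℝ) : ℝ :=
  sSup {q : ℝ | ∃ x ∈ closedCube n, ∃ y ∈ closedCube n, x ≠ y ∧ q = |f x - f y| / ‖x - y‖}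

/-- The Hamiltonian `H(x,z,p) = ∏ᵢ (z + n xᵢ pᵢ)₊`. -/
noncomputable def hamiltonian {n : ℕ} (x : EuclideanSpace ℝ (Fin n)) (z : ℝ) (p : Fin n → ℝ) : ℝ :=
  ∏ i, max (z + n * x i * p i) 0

/-- The vector of partial derivatives of `φ` at `x`. -/
noncomputable def partials {n : ℕ} (φ : EuclideanSpace ℝ (Fin n) → ℝ)
    (x : EuclideanSpace ℝ (Fin n)) : Fin n → ℝ :=
  fun i => fderiv ℝ φ x (EuclideanSpace.single i 1)

/-- `w` is a viscosity subsolution of `H(x,w,Dw) = f` on `(0,1]^n`; local maxima are taken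
relative to `(0,1]^n`, so that points with some `xᵢ = 1` are included. -/
def IsViscositySubsolution {n : ℕ} (f w : EuclideanSpace ℝ (Fin n) → ℝ) : Prop :=
  UpperSemicontinuousOn w (halfOpenCube n) ∧
  ∀ x ∈ halfOpenCube n, ∀ φ : EuclideanSpace ℝ (Fin n) → ℝ, ContDiff ℝ 1 φ →
    IsLocalMaxOn (fun y => w y - φ y) (halfOpenCube n) x →
      hamiltonian x (w x) (partials φ x) ≤ f x

/-- `w` is a viscosity supersolution of `H(x,w,Dw) = f` on `(0,1]^n`. -/
def IsViscositySupersolution {n : ℕ} (f w : EuclideanSpace ℝ (Fin n) → ℝ) : Prop :=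
  LowerSemicontinuousOn w (halfOpenCube n) ∧
  ∀ x ∈ halfOpenCube n, ∀ φ : EuclideanSpace ℝ (Fin n) → ℝ, ContDiff ℝ 1 φ →
    IsLocalMinOn (fun y => w y - φ y) (halfOpenCube n) x →
      f x ≤ hamiltonian x (w x) (partials φ x)

/-- `w` is a bounded viscosity solution of `H(x,w,Dw) = f` on `(0,1]^n`. -/
def IsBoundedViscositySolution {n : ℕ} (f w : EuclideanSpace ℝ (Fin n) → ℝ) : Prop :=
  IsViscositySubsolution f w ∧ IsViscositySupersolution f w ∧
  ∃ M : ℝ, ∀ x ∈ halfOpenCube n, |w x| ≤ M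

/-- `w` is the maximal (that is, the pointwise greatest) bounded viscosity solution of
`H(x,w,Dw) = f` on `(0,1]^n`. -/
def IsMaximalBoundedViscositySolution {n : ℕ} (f w : EuclideanSpace ℝ (Fin n) → ℝ) : Prop :=
  IsBoundedViscositySolution f w ∧
  ∀ v : EuclideanSpace ℝ (Fin n) → ℝ, IsBoundedViscositySolution f v →
    ∀ x ∈ halfOpenCube n, v x ≤ w x

/-- The backward difference quotients at `x` of the function that has the value `t` at `x` and
agrees with `u` at the points `x - h eᵢ`. -/
noncomputable def backwardDiff {n : ℕ} (h : ℝ) (u : EuclideanSpace ℝ (Fin n) → ℝ)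
    (x : EuclideanSpace ℝ (Fin n)) (t : ℝ) : Fin n → ℝ :=
  fun i => (t - u (x - h • EuclideanSpace.single i 1)) / h

/-- `u` is the maximal solution of the scheme `H(x,u,D⁻u) = f` on the grid: at each grid point `x`
the value `u x` is the largest `t ≥ 0` that solves the equation at `x`, given the values of `u` at
the points `x - h eᵢ`. If `xᵢ = 0`, then `D⁻ᵢ u (x)` is multiplied by `0`, so the value of `u`
outside the grid has no influence. -/
def IsMaximalSchemeSolution {n : ℕ} (h : ℝ) (f u : EuclideanSpace ℝ (Fin n) → ℝ) : Prop :=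
  ∀ x ∈ cubeGrid n h,
    IsGreatest {t : ℝ | 0 ≤ t ∧ hamiltonian x t (backwardDiff h u x t) = f x} (u x)

/-!
The error estimate is a doubling of variables for the equation `∏ (w + n xᵢ ∂ᵢw)₊ = f`. In the
variables `log xᵢ` the Hamiltonian depends on `x` no longer, and it is strictly increasing in `w`:
if `∏ aᵢ₊ ≥ f y ≥ m > 0`, `∏ bᵢ₊ ≤ f x` and `bᵢ ≥ aᵢ + c` with `c ≥ 0`, then
`c ≤ [f]₁ |x - y| / min m 1` (`mul_min_one_le_prod_sub_prod`).

At a maximum point of `u x - v y - |x - y|² / (2ε)`, with `u` a subsolution and `v` a supersolution,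
both test functions have the gradient `p = (x - y) / ε`, and `xᵢ pᵢ ≥ yᵢ pᵢ`. So
`u x - v y ≤ L |x - y|` with `L = [f]₁ / min m 1`, and by Young's inequality the maximum is at most
`L² ε / 2`, whatever the regularity of `u` and `v` (`sub_le_quadPenalty_add`). Because the
Hamiltonian increases in each `pᵢ` and test functions touch relative to `(0,1]^n`, the faces
`xᵢ = 1` need no care. Maximum points are kept off the faces `xᵢ = 0` by a penalty `-δ ∑ log xᵢ`,
which changes the factors by the constant `n δ` only. The scheme satisfies the same inequalities at
maxima over the grid, up to the difference quotient error `h / (2ε)` of the quadratic penalty.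

This comparison is used three times. With `w` against itself it gives
`w x - w y ≤ |x - y|² / (2ε) + L² ε / 2` for every `ε`, so `w` is Lipschitz and extends
continuously to the closed cube. With `w` against `w_h`, in both orders and with `ε = √h`, it gives
`|w x - w_h y| ≤ |x - y|² / (2√h) + (n + L²) √h / 2`, and letting `x` tend to `y` gives the claim.
-/

open Set Filter Topology

/-! ### The elementary product inequality -/

/-- Raising every factor of a product of positive parts by `c` raises the product at least
linearly in `c`. The crude slope `min m 1` is enough and avoids `n`-th roots: if the factor `aᵢ` is
at most one, then the product of the others is at least `m`, and if no factor is at most one, then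
the product of the others is at least `1`. -/
theorem mul_min_one_le_prod_sub_prod {n : ℕ} (hn : 1 ≤ n) {a b : Fin n → ℝ} {c m : ℝ} (hm : 0 < m)
    (hc : 0 ≤ c) (hab : ∀ i, a i + c ≤ b i) (ha : m ≤ ∏ i, max (a i) 0) :
    c * min m 1 ≤ ∏ i, max (b i) 0 - ∏ i, max (a i) 0 := by
  have hpos : ∀ i, 0 < a i := by
    intro i
    by_contra hi
    have h0 : ∏ i, max (a i) 0 = 0 :=
      Finset.prod_eq_zero (Finset.mem_univ i) (max_eq_right (not_lt.mp hi))
    linarith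
  have hae : ∀ i, max (a i) 0 = a i := fun i => max_eq_left (hpos i).le
  have hbe : ∀ i, max (b i) 0 = b i := fun i => max_eq_left (by linarith [hpos i, hab i])
  simp only [hae, hbe] at ha ⊢
  obtain ⟨i, hi⟩ : ∃ i : Fin n, min m 1 ≤ ∏ j ∈ Finset.univ.erase i, a j := by
    by_cases h1 : ∃ i, a i ≤ 1
    · obtain ⟨i, hi⟩ := h1
      refine ⟨i, (min_le_left _ _).trans ?_⟩
      rw [← Finset.mul_prod_erase _ _ (Finset.mem_univ i)] at ha
      have hq : 0 ≤ ∏ j ∈ Finset.univ.erase i, a j := Finset.prod_nonneg fun j _ => (hpos j).le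
      nlinarith
    · push Not at h1
      exact ⟨⟨0, hn⟩, (min_le_right _ _).trans (Finset.one_le_prod fun j _ => (h1 j).le)⟩
  have hprod : ∏ j ∈ Finset.univ.erase i, a j ≤ ∏ j ∈ Finset.univ.erase i, b j :=
    Finset.prod_le_prod (fun j _ => (hpos j).le) fun j _ => by linarith [hab j]
  rw [← Finset.mul_prod_erase _ a (Finset.mem_univ i),
    ← Finset.mul_prod_erase _ b (Finset.mem_univ i)]
  have h0 : 0 ≤ min m 1 := (lt_min hm one_pos).le
  have hq := h0.trans hi
  calc c * min m 1 ≤ c * ∏ j ∈ Finset.univ.erase i, a j := mul_le_mul_of_nonneg_left hi hc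
    _ = (a i + c) * ∏ j ∈ Finset.univ.erase i, a j - a i * ∏ j ∈ Finset.univ.erase i, a j := by ring
    _ ≤ _ := sub_le_sub_right (mul_le_mul (hab i) hprod hq (by linarith [hpos i, hab i])) _

theorem hamiltonian_mono {n : ℕ} {x y : EuclideanSpace ℝ (Fin n)} {s t : ℝ} {p q : Fin n → ℝ}
    (h : ∀ i, s + n * x i * p i ≤ t + n * y i * q i) : hamiltonian x s p ≤ hamiltonian y t q :=
  Finset.prod_le_prod (fun _ _ => le_max_right _ _) fun i _ => max_le_max_right 0 (h i)

/-! ### Doubling of variables -/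

/-- The penalty `|x - y|² / (2ε)`. -/
noncomputable def quadPenalty {n : ℕ} (ε : ℝ) (x y : EuclideanSpace ℝ (Fin n)) : ℝ :=
  ∑ i, (x i - y i) ^ 2 / (2 * ε)

theorem quadPenalty_eq_norm {n : ℕ} (ε : ℝ) (x y : EuclideanSpace ℝ (Fin n)) :
    quadPenalty ε x y = ‖x - y‖ ^ 2 / (2 * ε) := by
  rw [quadPenalty, EuclideanSpace.norm_sq_eq, Finset.sum_div]
  simp

theorem continuous_quadPenalty {n : ℕ} (ε : ℝ) :
    Continuous fun z : EuclideanSpace ℝ (Fin n) × EuclideanSpace ℝ (Fin n) =>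
      quadPenalty ε z.1 z.2 := by
  simp only [quadPenalty_eq_norm]
  fun_prop

/-- `u` satisfies the subsolution inequality on `A`, up to the error `n e` in the zeroth order term,
at every maximum point over `A` of `u - P - |· - y|² / (2ε)`, where `P` is an extra penalty whose
gradient has been absorbed in `e`. This covers the equation on `(0,1]^n` and the scheme on the
grid alike. -/
def IsPenalizedSubsolution {n : ℕ} (f : EuclideanSpace ℝ (Fin n) → ℝ)
    (A : Set (EuclideanSpace ℝ (Fin n))) (ε e : ℝ) (P u : EuclideanSpace ℝ (Fin n) → ℝ) : Prop :=
  ∀ x ∈ A, ∀ y, (∀ z ∈ A, u z - P z - quadPenalty ε z y ≤ u x - P x - quadPenalty ε x y) →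
    hamiltonian x (u x - n * e) (fun i => (x i - y i) / ε) ≤ f x

/-- `v` satisfies the supersolution inequality on `B`, up to the error `n e` in the zeroth order
term, at every minimum point over `B` of `v + P + |x - ·|² / (2ε)`. -/
def IsPenalizedSupersolution {n : ℕ} (f : EuclideanSpace ℝ (Fin n) → ℝ)
    (B : Set (EuclideanSpace ℝ (Fin n))) (ε e : ℝ) (P v : EuclideanSpace ℝ (Fin n) → ℝ) : Prop :=
  ∀ y ∈ B, ∀ x, (∀ z ∈ B, v y + P y + quadPenalty ε x y ≤ v z + P z + quadPenalty ε x z) →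
    f y ≤ hamiltonian y (v y + n * e) (fun i => (x i - y i) / ε)

/-- The condition under which penalized maxima exist. -/
def HasCompactSuperlevels {n : ℕ} (A : Set (EuclideanSpace ℝ (Fin n)))
    (F : EuclideanSpace ℝ (Fin n) → ℝ) : Prop :=
  ContinuousOn F A ∧ ∀ r, IsCompact {x ∈ A | r ≤ F x}

theorem HasCompactSuperlevels.exists_le {n : ℕ} {A : Set (EuclideanSpace ℝ (Fin n))}
    {F : EuclideanSpace ℝ (Fin n) → ℝ} (hF : HasCompactSuperlevels A F)
    {x₀ : EuclideanSpace ℝ (Fin n)} (hx₀ : x₀ ∈ A) : ∃ M, ∀ x ∈ A, F x ≤ M := by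
  obtain ⟨x, -, hx⟩ := (hF.2 (F x₀)).exists_isMaxOn ⟨x₀, hx₀, le_rfl⟩
    (hF.1.mono fun _ h => h.1)
  refine ⟨max (F x) (F x₀), fun z hz => ?_⟩
  rcases le_total (F x₀) (F z) with h | h
  · exact (hx ⟨hz, h⟩).trans (le_max_left _ _)
  · exact h.trans (le_max_right _ _)

theorem exists_doubled_max {n : ℕ} {A B : Set (EuclideanSpace ℝ (Fin n))}
    {F G : EuclideanSpace ℝ (Fin n) → ℝ} {ε : ℝ} (hε : 0 < ε) (hF : HasCompactSuperlevels A F)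
    (hG : HasCompactSuperlevels B G) {x₀ y₀ : EuclideanSpace ℝ (Fin n)} (hx₀ : x₀ ∈ A)
    (hy₀ : y₀ ∈ B) :
    ∃ x ∈ A, ∃ y ∈ B, ∀ x' ∈ A, ∀ y' ∈ B,
      F x' + G y' - quadPenalty ε x' y' ≤ F x + G y - quadPenalty ε x y := by
  have hq : ∀ x y : EuclideanSpace ℝ (Fin n), 0 ≤ quadPenalty ε x y := fun x y =>
    Finset.sum_nonneg fun i _ => by positivity
  obtain ⟨M, hM⟩ := hF.exists_le hx₀
  obtain ⟨N, hN⟩ := hG.exists_le hy₀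
  set R := F x₀ + G y₀ - quadPenalty ε x₀ y₀ with hR
  have hK := (hF.2 (R - N)).prod (hG.2 (R - M))
  have hcont : ContinuousOn (fun z : EuclideanSpace ℝ (Fin n) × EuclideanSpace ℝ (Fin n) =>
      F z.1 + G z.2 - quadPenalty ε z.1 z.2) ({x ∈ A | R - N ≤ F x} ×ˢ {y ∈ B | R - M ≤ G y}) := by
    refine ((hF.1.comp continuousOn_fst fun z hz => hz.1.1).add
      (hG.1.comp continuousOn_snd fun z hz => hz.2.1)).sub (continuous_quadPenalty ε).continuousOn
  have hmem : ∀ x ∈ A, ∀ y ∈ B, R ≤ F x + G y - quadPenalty ε x y →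
      (x, y) ∈ {x ∈ A | R - N ≤ F x} ×ˢ {y ∈ B | R - M ≤ G y} := by
    intro x hx y hy h
    have := hM x hx
    have := hN y hy
    have := hq x y
    exact ⟨⟨hx, by linarith⟩, ⟨hy, by linarith⟩⟩
  have h₀ := hmem x₀ hx₀ y₀ hy₀ le_rfl
  obtain ⟨⟨x, y⟩, hxy, hmax⟩ := hK.exists_isMaxOn ⟨_, h₀⟩ hcont
  refine ⟨x, hxy.1.1, y, hxy.2.1, fun x' hx' y' hy' => ?_⟩
  rcases le_total R (F x' + G y' - quadPenalty ε x' y') with h | h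
  · exact hmax (hmem x' hx' y' hy' h)
  · exact h.trans (hmax h₀)

/-- The comparison estimate. At a maximum point `(x, y)` of
`u x - v y - |x - y|² / (2ε) - P x - Q y` the two equations have the same gradient
`p = (x - y) / ε`, and `xᵢ pᵢ ≥ yᵢ pᵢ`, so the product inequality bounds `u x - v y` by
`L |x - y| + n (e + e')`; the quadratic penalty then absorbs `L |x - y|`. -/
theorem sub_le_quadPenalty_add {n : ℕ} (hn : 1 ≤ n) {f : EuclideanSpace ℝ (Fin n) → ℝ}
    {A B : Set (EuclideanSpace ℝ (Fin n))} {m F ε e e' : ℝ}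
    {P Q u v : EuclideanSpace ℝ (Fin n) → ℝ} (hm : 0 < m) (hF : 0 ≤ F) (hε : 0 < ε)
    (hfm : ∀ y ∈ B, m ≤ f y) (hfL : ∀ x ∈ A, ∀ y ∈ B, f x - f y ≤ F * ‖x - y‖)
    (hP : ∀ x ∈ A, 0 ≤ P x) (hQ : ∀ y ∈ B, 0 ≤ Q y)
    (hu : IsPenalizedSubsolution f A ε e P u) (hv : IsPenalizedSupersolution f B ε e' Q v)
    (hcu : HasCompactSuperlevels A fun x => u x - P x)
    (hcv : HasCompactSuperlevels B fun y => -v y - Q y)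
    {x₀ y₀ : EuclideanSpace ℝ (Fin n)} (hx₀ : x₀ ∈ A) (hy₀ : y₀ ∈ B) :
    u x₀ - v y₀ ≤ quadPenalty ε x₀ y₀ + P x₀ + Q y₀ + n * (e + e') + (F / min m 1) ^ 2 * ε / 2 := by
  obtain ⟨x, hx, y, hy, hmax⟩ := exists_doubled_max hε hcu hcv hx₀ hy₀
  have h1 := hu x hx y fun z hz => by linarith [hmax z hz y hy]
  have h2 := hv y hy x fun z hz => by linarith [hmax x hx z hz]
  have h3 := hmax x₀ hx₀ y₀ hy₀
  have hPx := hP x hx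
  have hQy := hQ y hy
  set c := u x - v y - n * (e + e') with hc
  have hmin : 0 < min m 1 := lt_min hm one_pos
  have key : c ≤ F / min m 1 * ‖x - y‖ := by
    rcases le_or_gt c 0 with h | h
    · exact h.trans (by positivity)
    · have h4 := mul_min_one_le_prod_sub_prod hn hm h.le
        (a := fun i => v y + n * e' + n * y i * ((x i - y i) / ε))
        (b := fun i => u x - n * e + n * x i * ((x i - y i) / ε)) (fun i => ?_)
        ((hfm y hy).trans h2)
      · have h5 := hfL x hx y hy
        unfold hamiltonian at h1 h2
        rw [div_mul_eq_mul_div, le_div_iff₀ hmin]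
        linarith
      · have h6 : 0 ≤ n * ((x i - y i) ^ 2 / ε) := by positivity
        have h7 : n * ((x i - y i) ^ 2 / ε) =
          n * x i * ((x i - y i) / ε) - n * y i * ((x i - y i) / ε) := by ring
        linarith
  have hyoung : F / min m 1 * ‖x - y‖ ≤ quadPenalty ε x y + (F / min m 1) ^ 2 * ε / 2 := by
    rw [quadPenalty_eq_norm]
    have h8 : ‖x - y‖ ^ 2 / (2 * ε) + (F / min m 1) ^ 2 * ε / 2 - F / min m 1 * ‖x - y‖ =
      (‖x - y‖ - F / min m 1 * ε) ^ 2 / (2 * ε) := by field_simp; ring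
    have h9 : 0 ≤ (‖x - y‖ - F / min m 1 * ε) ^ 2 / (2 * ε) := by positivity
    linarith
  linarith

/-! ### Viscosity solutions as penalized solutions -/

/-- The penalty `-δ ∑ log xᵢ`, which keeps maximum points away from the faces `xᵢ = 0`. Since
`xᵢ ∂ᵢ` maps it to a constant, it only shifts the zeroth order term of the equation. -/
noncomputable def logPenalty {n : ℕ} (δ : ℝ) (x : EuclideanSpace ℝ (Fin n)) : ℝ :=
  ∑ i, -(δ * Real.log (x i))

theorem logPenalty_nonneg {n : ℕ} {δ : ℝ} (hδ : 0 ≤ δ) {x : EuclideanSpace ℝ (Fin n)}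
    (hx : x ∈ halfOpenCube n) : 0 ≤ logPenalty δ x :=
  Finset.sum_nonneg fun i _ => neg_nonneg.mpr
    (mul_nonpos_of_nonneg_of_nonpos hδ (Real.log_nonpos (hx i).1.le (hx i).2))

theorem hasCompactSuperlevels_sub_logPenalty {n : ℕ} {δ M : ℝ} (hδ : 0 < δ)
    {u : EuclideanSpace ℝ (Fin n) → ℝ} (hu : ContinuousOn u (halfOpenCube n))
    (hM : ∀ x ∈ halfOpenCube n, u x ≤ M) :
    HasCompactSuperlevels (halfOpenCube n) fun x => u x - logPenalty δ x := by
  have hcont : ContinuousOn (fun x => u x - logPenalty δ x) (halfOpenCube n) := by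
    refine hu.sub (continuousOn_finsetSum _ fun i _ => ContinuousOn.neg ?_)
    exact continuousOn_const.mul (ContinuousOn.log (by fun_prop) fun x hx => (hx i).1.ne')
  refine ⟨hcont, fun r => ?_⟩
  set s := Real.exp ((r - M) / δ) with hs
  have hs0 : 0 < s := Real.exp_pos _
  set T : Set (EuclideanSpace ℝ (Fin n)) := {x | ∀ i, x i ∈ Icc s 1} with hT
  have hTc : IsCompact T := by
    have := (isCompact_univ_pi (X := fun _ : Fin n => ℝ) fun _ => isCompact_Icc (a := s) (b := 1)).image
      (PiLp.continuous_toLp 2 (fun _ : Fin n => ℝ))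
    refine this.of_isClosed_subset ?_ fun x hx => ⟨WithLp.ofLp x, fun i _ => hx i, rfl⟩
    simp only [hT, ofPred_forall]
    exact isClosed_iInter fun i => isClosed_Icc.preimage (by fun_prop)
  have hTA : T ⊆ halfOpenCube n := fun x hx i => ⟨hs0.trans_le (hx i).1, (hx i).2⟩
  have hcl := (hcont.mono hTA).preimage_isClosed_of_isClosed hTc.isClosed (isClosed_Ici (a := r))
  convert hTc.of_isClosed_subset hcl inter_subset_left using 1
  ext x
  refine ⟨fun ⟨hx, hr⟩ => ⟨fun i => ⟨?_, (hx i).2⟩, hr⟩, fun ⟨hx, hr⟩ => ⟨hTA hx, hr⟩⟩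
  have h1 : -(δ * Real.log (x i)) ≤ logPenalty δ x :=
    Finset.single_le_sum (f := fun i => -(δ * Real.log (x i))) (fun j _ => neg_nonneg.mpr
      (mul_nonpos_of_nonneg_of_nonpos hδ.le (Real.log_nonpos (hx j).1.le (hx j).2)))
      (Finset.mem_univ i)
  -- `δ log xᵢ ≥ r - M`, as the other terms of the penalty are nonnegative
  rw [hs, ← Real.le_log_iff_exp_le (hx i).1, div_le_iff₀ hδ]
  have := hM x hx
  have hr' : r ≤ u x - logPenalty δ x := hr
  linarith

/-- The polynomial in one coordinate that touches `(s - b)² / (2ε) - δ log s` from above at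
`s = a > 0`. The test functions of the viscosity inequalities are differentiable everywhere, which
the logarithm is not. -/
noncomputable def touchingPoly (ε δ a b s : ℝ) : ℝ :=
  (s - b) ^ 2 / (2 * ε) + δ * (-Real.log a - (s / a - 1) + 2 * (s / a - 1) ^ 2)

theorem touchingPoly_self {ε δ a b : ℝ} (ha : 0 < a) :
    touchingPoly ε δ a b a = (a - b) ^ 2 / (2 * ε) + -(δ * Real.log a) := by
  simp [touchingPoly, div_self ha.ne']

theorem le_touchingPoly {ε δ a b s : ℝ} (hδ : 0 ≤ δ) (ha : 0 < a) (hs : a / 2 < s) :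
    (s - b) ^ 2 / (2 * ε) + -(δ * Real.log s) ≤ touchingPoly ε δ a b s := by
  have hs0 : 0 < s := by linarith
  have ht : 1 / 2 < s / a := by rw [lt_div_iff₀ ha]; linarith
  have ht0 : 0 < s / a := by linarith
  have h1 := Real.one_sub_inv_le_log_of_pos ht0
  rw [Real.log_div hs0.ne' ha.ne'] at h1
  have h2 : (s / a)⁻¹ - 1 ≤ -(s / a - 1) + 2 * (s / a - 1) ^ 2 := by
    generalize s / a = t at *
    have h3 : -(t - 1) + 2 * (t - 1) ^ 2 - (t⁻¹ - 1) = (t - 1) ^ 2 * (2 * t - 1) / t := by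
      field_simp; ring
    have h4 : 0 ≤ (t - 1) ^ 2 * (2 * t - 1) / t := by
      have : 0 ≤ 2 * t - 1 := by linarith
      positivity
    linarith
  have h5 : -Real.log s ≤ -Real.log a - (s / a - 1) + 2 * (s / a - 1) ^ 2 := by linarith
  have h6 := mul_le_mul_of_nonneg_left h5 hδ
  unfold touchingPoly
  linarith

theorem hasDerivAt_touchingPoly {ε δ a b : ℝ} (ha : 0 < a) :
    HasDerivAt (touchingPoly ε δ a b) ((a - b) / ε - δ / a) a := by
  have hid := hasDerivAt_id a
  have h1 := ((hid.sub_const b).pow 2).div_const (2 * ε)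
  have h2 := (hid.div_const a).sub_const 1
  have h3 := ((h2.const_sub (-Real.log a)).add ((h2.pow 2).const_mul 2)).const_mul δ
  have h4 := h1.add h3
  simp only [id_eq, div_self ha.ne'] at h4
  refine h4.congr_deriv ?_
  norm_num
  ring

theorem contDiff_touchingPoly (ε δ a b : ℝ) : ContDiff ℝ 1 (touchingPoly ε δ a b) := by
  unfold touchingPoly
  fun_prop

theorem partials_sum_comp_apply {n : ℕ} {g : Fin n → ℝ → ℝ} {d : Fin n → ℝ}
    {x : EuclideanSpace ℝ (Fin n)} (hg : ∀ i, HasDerivAt (g i) (d i) (x i)) :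
    partials (fun z : EuclideanSpace ℝ (Fin n) => ∑ i, g i (z i)) x = d := by
  have h : HasFDerivAt (fun z : EuclideanSpace ℝ (Fin n) => ∑ i, g i (z i))
      (∑ i, d i • (EuclideanSpace.proj i : EuclideanSpace ℝ (Fin n) →L[ℝ] ℝ)) x :=
    HasFDerivAt.fun_sum fun i _ => (hg i).comp_hasFDerivAt x
      (EuclideanSpace.proj i : EuclideanSpace ℝ (Fin n) →L[ℝ] ℝ).hasFDerivAt
  ext j
  simp [partials, h.fderiv, PiLp.single_apply]

theorem eventually_le_sum_touchingPoly {n : ℕ} {ε δ : ℝ} (hδ : 0 ≤ δ)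
    {x : EuclideanSpace ℝ (Fin n)} (hx : x ∈ halfOpenCube n) (y : EuclideanSpace ℝ (Fin n)) :
    ∀ᶠ z in 𝓝[halfOpenCube n] x, z ∈ halfOpenCube n ∧
      quadPenalty ε z y + logPenalty δ z ≤ ∑ i, touchingPoly ε δ (x i) (y i) (z i) := by
  have h : ∀ᶠ z : EuclideanSpace ℝ (Fin n) in 𝓝 x, ∀ i, x i / 2 < z i := by
    refine eventually_all.mpr fun i => ?_
    have : Continuous fun z : EuclideanSpace ℝ (Fin n) => z i := by fun_prop
    exact this.continuousAt.eventually_const_lt (by linarith [(hx i).1])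
  filter_upwards [self_mem_nhdsWithin, nhdsWithin_le_nhds h] with z hz hz'
  refine ⟨hz, ?_⟩
  rw [quadPenalty, logPenalty, ← Finset.sum_add_distrib]
  exact Finset.sum_le_sum fun i _ => le_touchingPoly hδ (hx i).1 (hz' i)

theorem sum_touchingPoly_self {n : ℕ} {ε δ : ℝ}
    {x : EuclideanSpace ℝ (Fin n)} (hx : x ∈ halfOpenCube n) (y : EuclideanSpace ℝ (Fin n)) :
    ∑ i, touchingPoly ε δ (x i) (y i) (x i) = quadPenalty ε x y + logPenalty δ x := by
  rw [quadPenalty, logPenalty, ← Finset.sum_add_distrib]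
  exact Finset.sum_congr rfl fun i _ => touchingPoly_self (hx i).1

theorem IsViscositySubsolution.isPenalizedSubsolution {n : ℕ}
    {f w : EuclideanSpace ℝ (Fin n) → ℝ} (hw : IsViscositySubsolution f w) (ε : ℝ) {δ : ℝ}
    (hδ : 0 ≤ δ) : IsPenalizedSubsolution f (halfOpenCube n) ε δ (logPenalty δ) w := by
  intro x hx y hmax
  have hd : ∀ i, HasDerivAt (touchingPoly ε δ (x i) (y i)) ((x i - y i) / ε - δ / x i) (x i) :=
    fun i => hasDerivAt_touchingPoly (hx i).1
  have h := hw.2 x hx (fun z => ∑ i, touchingPoly ε δ (x i) (y i) (z i))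
    (ContDiff.sum fun i _ => (contDiff_touchingPoly _ _ _ _).comp (by fun_prop)) (by
      filter_upwards [eventually_le_sum_touchingPoly (ε := ε) hδ hx y] with z hz
      have h1 := hmax z hz.1
      have h2 := hz.2
      simp only [sum_touchingPoly_self hx y]
      linarith)
  rw [partials_sum_comp_apply hd] at h
  refine (hamiltonian_mono fun i => le_of_eq ?_).trans h
  have := (hx i).1.ne'
  field_simp
  ring

theorem IsViscositySupersolution.isPenalizedSupersolution {n : ℕ}
    {f w : EuclideanSpace ℝ (Fin n) → ℝ} (hw : IsViscositySupersolution f w) (ε : ℝ) {δ : ℝ}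
    (hδ : 0 ≤ δ) : IsPenalizedSupersolution f (halfOpenCube n) ε δ (logPenalty δ) w := by
  intro y hy x hmin
  have hsymm : ∀ z, quadPenalty ε x z = quadPenalty ε z x := fun z =>
    Finset.sum_congr rfl fun i _ => by ring
  have hd : ∀ i, HasDerivAt (fun s => -touchingPoly ε δ (y i) (x i) s)
      (-((y i - x i) / ε - δ / y i)) (y i) := fun i => (hasDerivAt_touchingPoly (hy i).1).neg
  have h := hw.2 y hy (fun z => ∑ i, -touchingPoly ε δ (y i) (x i) (z i))
    (ContDiff.sum fun i _ => ((contDiff_touchingPoly _ _ _ _).comp (by fun_prop)).neg) (by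
      filter_upwards [eventually_le_sum_touchingPoly (ε := ε) hδ hy x] with z hz
      have h1 := hmin z hz.1
      have h2 := hz.2
      simp only [Finset.sum_neg_distrib, sum_touchingPoly_self hy x]
      rw [hsymm, hsymm] at h1
      linarith)
  rw [partials_sum_comp_apply hd] at h
  refine h.trans (hamiltonian_mono fun i => le_of_eq ?_)
  have := (hy i).1.ne'
  field_simp
  ring

/-! ### The scheme as a penalized equation -/

theorem cubeGrid_finite (n : ℕ) {h : ℝ} (hh : 0 < h) : (cubeGrid n h).Finite := by
  have hfin : (Set.univ.pi fun _ : Fin n => Icc (0 : ℤ) ⌈1 / h⌉).Finite :=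
    Set.Finite.pi fun _ => finite_Icc _ _
  refine (hfin.image fun k : Fin n → ℤ => WithLp.toLp 2 fun i => h * (k i : ℝ)).subset ?_
  intro x hx
  choose k hk using hx.2
  refine ⟨k, fun i _ => ?_, ?_⟩
  · have h1 := hx.1 i
    rw [hk i] at h1
    refine ⟨?_, ?_⟩
    · have : (0 : ℝ) ≤ k i := nonneg_of_mul_nonneg_right h1.1 hh
      exact_mod_cast this
    · have : (k i : ℝ) ≤ 1 / h := by rw [le_div_iff₀ hh]; linarith [h1.2]
      exact_mod_cast this.trans (Int.le_ceil _)
  · ext i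
    exact (hk i).symm

theorem hasCompactSuperlevels_of_finite {n : ℕ} {A : Set (EuclideanSpace ℝ (Fin n))}
    (hA : A.Finite) (F : EuclideanSpace ℝ (Fin n) → ℝ) : HasCompactSuperlevels A F :=
  ⟨hA.continuousOn F, fun _ => (hA.subset fun _ h => h.1).isCompact⟩

theorem sub_smul_single_apply {n : ℕ} (h : ℝ) (x : EuclideanSpace ℝ (Fin n)) (i j : Fin n) :
    (x - h • EuclideanSpace.single i (1 : ℝ)) j = x j - if j = i then h else 0 := by
  simp [PiLp.single_apply]

theorem sub_single_mem_cubeGrid {n : ℕ} {h : ℝ} (hh : 0 < h) {x : EuclideanSpace ℝ (Fin n)}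
    (hx : x ∈ cubeGrid n h) {i : Fin n} (hi : x i ≠ 0) :
    x - h • EuclideanSpace.single i 1 ∈ cubeGrid n h := by
  obtain ⟨k, hk⟩ := hx.2 i
  have hk1 : 1 ≤ k := by
    have h1 : 0 < x i := lt_of_le_of_ne (hx.1 i).1 hi.symm
    rw [hk] at h1
    have : (0 : ℝ) < k := pos_of_mul_pos_right h1 hh.le
    exact_mod_cast this
  have hk1' : (1 : ℝ) ≤ k := by exact_mod_cast hk1
  refine ⟨fun j => ?_, fun j => ?_⟩ <;> rw [sub_smul_single_apply]
  · by_cases hj : j = i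
    · subst hj
      have := (hx.1 j).2
      rw [if_pos rfl]
      exact ⟨by rw [hk]; nlinarith, by linarith⟩
    · simpa [hj] using hx.1 j
  · by_cases hj : j = i
    · subst hj
      exact ⟨k - 1, by rw [if_pos rfl, hk]; push_cast; ring⟩
    · simpa [hj] using hx.2 j

theorem quadPenalty_sub_single {n : ℕ} {ε : ℝ} (hε : 0 < ε) (h : ℝ)
    (x y : EuclideanSpace ℝ (Fin n)) (i : Fin n) :
    quadPenalty ε (x - h • EuclideanSpace.single i 1) y =
      quadPenalty ε x y - h * ((x i - y i) / ε) + h * (h / (2 * ε)) := by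
  have hterm : ∀ j, ((x - h • EuclideanSpace.single i (1 : ℝ)) j - y j) ^ 2 / (2 * ε) =
      (x j - y j) ^ 2 / (2 * ε) +
        if j = i then -(h * ((x i - y i) / ε)) + h * (h / (2 * ε)) else 0 := by
    intro j
    rw [sub_smul_single_apply]
    by_cases hj : j = i
    · subst hj
      simp only [if_true]
      field_simp
      ring
    · simp [hj]
  simp only [quadPenalty, hterm, Finset.sum_add_distrib, Finset.sum_ite_eq', Finset.mem_univ,
    if_true]
  ring

/-- The difference quotient of the quadratic penalty is its derivative up to `h / (2ε)`, whence the
error in the zeroth order term. -/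
theorem IsMaximalSchemeSolution.isPenalizedSubsolution {n : ℕ} {h ε : ℝ} (hh : 0 < h)
    (hε : 0 < ε) {f u : EuclideanSpace ℝ (Fin n) → ℝ} (hu : IsMaximalSchemeSolution h f u) :
    IsPenalizedSubsolution f (cubeGrid n h) ε (h / (2 * ε)) (fun _ => 0) u := by
  intro x hx y hmax
  rw [← (hu x hx).1.2]
  refine hamiltonian_mono fun i => ?_
  have he : 0 ≤ h / (2 * ε) := by positivity
  by_cases hi : x i = 0
  -- on a face `xᵢ = 0` both first order terms vanish
  · simp only [hi, mul_zero, zero_mul, add_zero]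
    have : 0 ≤ n * (h / (2 * ε)) := by positivity
    linarith
  · have h1 := hmax _ (sub_single_mem_cubeGrid hh hx hi)
    rw [quadPenalty_sub_single hε] at h1
    have h2 : (x i - y i) / ε - h / (2 * ε) ≤ backwardDiff h u x (u x) i := by
      rw [backwardDiff, le_div_iff₀ hh]
      linarith
    have hn0 : (0 : ℝ) ≤ n * x i := mul_nonneg n.cast_nonneg (hx.1 i).1
    have h3 := mul_le_mul_of_nonneg_left h2 hn0
    have h4 : n * x i * (h / (2 * ε)) ≤ n * (h / (2 * ε)) :=
      mul_le_mul_of_nonneg_right (mul_le_of_le_one_right n.cast_nonneg (hx.1 i).2) he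
    linarith

theorem IsMaximalSchemeSolution.isPenalizedSupersolution {n : ℕ} {h ε : ℝ} (hh : 0 < h)
    (hε : 0 < ε) {f u : EuclideanSpace ℝ (Fin n) → ℝ} (hu : IsMaximalSchemeSolution h f u) :
    IsPenalizedSupersolution f (cubeGrid n h) ε (h / (2 * ε)) (fun _ => 0) u := by
  intro y hy x hmin
  have hsymm : ∀ z, quadPenalty ε x z = quadPenalty ε z x := fun z =>
    Finset.sum_congr rfl fun i _ => by ring
  rw [← (hu y hy).1.2]
  refine hamiltonian_mono fun i => ?_
  have he : 0 ≤ h / (2 * ε) := by positivity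
  by_cases hi : y i = 0
  · simp only [hi, mul_zero, zero_mul, add_zero]
    have : 0 ≤ n * (h / (2 * ε)) := by positivity
    linarith
  · have h1 := hmin _ (sub_single_mem_cubeGrid hh hy hi)
    rw [hsymm, hsymm, quadPenalty_sub_single hε] at h1
    have h2 : backwardDiff h u y (u y) i ≤ (x i - y i) / ε + h / (2 * ε) := by
      rw [backwardDiff, div_le_iff₀ hh]
      have h5 : (x i - y i) / ε = -((y i - x i) / ε) := by ring
      rw [h5]
      linarith
    have hn0 : (0 : ℝ) ≤ n * y i := mul_nonneg n.cast_nonneg (hy.1 i).1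
    have h3 := mul_le_mul_of_nonneg_left h2 hn0
    have h4 : n * y i * (h / (2 * ε)) ≤ n * (h / (2 * ε)) :=
      mul_le_mul_of_nonneg_right (mul_le_of_le_one_right n.cast_nonneg (hy.1 i).2) he
    linarith

/-! ### The cubes and the data -/

theorem halfOpenCube_subset_closedCube (n : ℕ) : halfOpenCube n ⊆ closedCube n :=
  fun _ hx i => ⟨(hx i).1.le, (hx i).2⟩

theorem isCompact_closedCube (n : ℕ) : IsCompact (closedCube n) := by
  have := (isCompact_univ_pi (X := fun _ : Fin n => ℝ) fun _ =>
    isCompact_Icc (a := (0 : ℝ)) (b := 1)).image (PiLp.continuous_toLp 2 (fun _ : Fin n => ℝ))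
  convert this using 1
  ext x
  exact ⟨fun hx => ⟨WithLp.ofLp x, fun i _ => hx i, rfl⟩,
    by rintro ⟨y, hy, rfl⟩ i; exact hy i trivial⟩

theorem closedCube_subset_closure_halfOpenCube (n : ℕ) :
    closedCube n ⊆ closure (halfOpenCube n) := by
  intro y hy
  set one : EuclideanSpace ℝ (Fin n) := WithLp.toLp 2 fun _ => 1 with hone
  have hc : Continuous fun t : ℝ => y + t • (one - y) := by fun_prop
  have ht : Tendsto (fun t : ℝ => y + t • (one - y)) (𝓝[>] 0) (𝓝 y) := by
    have := hc.tendsto 0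
    simp only [zero_smul, add_zero] at this
    exact this.mono_left nhdsWithin_le_nhds
  refine mem_closure_of_tendsto ht ?_
  filter_upwards [Ioo_mem_nhdsGT (zero_lt_one' ℝ)] with t ht i
  have h1 := hy i
  have h2 : (y + t • (one - y)) i = y i + t * (1 - y i) := by simp [hone]
  rw [h2]
  exact ⟨by nlinarith [ht.1, ht.2, h1.1, h1.2], by nlinarith [ht.1, ht.2, h1.1, h1.2]⟩

theorem lipSeminorm_nonneg {n : ℕ} (f : EuclideanSpace ℝ (Fin n) → ℝ) : 0 ≤ lipSeminorm f :=
  Real.sSup_nonneg (by rintro q ⟨x, -, y, -, -, rfl⟩; positivity)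

theorem sub_le_lipSeminorm_mul {n : ℕ} {f : EuclideanSpace ℝ (Fin n) → ℝ} {K : NNReal}
    (hf : LipschitzOnWith K f (closedCube n)) {x y : EuclideanSpace ℝ (Fin n)}
    (hx : x ∈ closedCube n) (hy : y ∈ closedCube n) :
    f x - f y ≤ lipSeminorm f * ‖x - y‖ := by
  rcases eq_or_ne x y with rfl | hxy
  · simp
  have hpos : ∀ {x y : EuclideanSpace ℝ (Fin n)}, x ≠ y → 0 < ‖x - y‖ := fun h =>
    norm_pos_iff.mpr (sub_ne_zero.mpr h)
  refine (le_abs_self _).trans ((div_le_iff₀ (hpos hxy)).mp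
    (le_csSup ⟨K, ?_⟩ ⟨x, hx, y, hy, hxy, rfl⟩))
  rintro q ⟨x, hx, y, hy, hxy, rfl⟩
  rw [div_le_iff₀ (hpos hxy)]
  simpa [Real.dist_eq, dist_eq_norm] using hf.dist_le_mul x hx y hy

theorem sInf_image_closedCube_pos {n : ℕ} {f : EuclideanSpace ℝ (Fin n) → ℝ}
    (hf : ContinuousOn f (closedCube n)) (hpos : ∀ x ∈ closedCube n, 0 < f x) :
    0 < sInf (f '' closedCube n) := by
  have hne : (closedCube n).Nonempty := ⟨0, fun i => by simp⟩
  obtain ⟨x, hx, hxe⟩ := ((isCompact_closedCube n).image_of_continuousOn hf).sInf_mem (hne.image f)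
  rw [← hxe]
  exact hpos x hx

theorem IsBoundedViscositySolution.continuousOn {n : ℕ} {f w : EuclideanSpace ℝ (Fin n) → ℝ}
    (hw : IsBoundedViscositySolution f w) : ContinuousOn w (halfOpenCube n) :=
  continuousOn_iff_lower_upperSemicontinuousOn.mpr ⟨hw.2.1.1, hw.1.1⟩

/-! ### The error estimate -/

/-- Comparison of `w` with itself at an arbitrary scale `ε`; `ε` proportional to `|x - y|` gives a Lipschitz bound
that holds up to the faces `xᵢ = 0`. -/
theorem IsBoundedViscositySolution.lipschitzOnWith {n : ℕ} (hn : 1 ≤ n)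
    {f w : EuclideanSpace ℝ (Fin n) → ℝ} (hw : IsBoundedViscositySolution f w) {m F : ℝ}
    (hm : 0 < m) (hF : 0 ≤ F) (hfm : ∀ x ∈ closedCube n, m ≤ f x)
    (hfL : ∀ x ∈ closedCube n, ∀ y ∈ closedCube n, f x - f y ≤ F * ‖x - y‖) :
    ∃ K, LipschitzOnWith K w (halfOpenCube n) := by
  have hsub := halfOpenCube_subset_closedCube n
  obtain ⟨M, hM⟩ := hw.2.2
  set L := F / min m 1 with hL
  have hL0 : 0 ≤ L := div_nonneg hF (lt_min hm one_pos).le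
  refine ⟨(L + 1).toNNReal, LipschitzOnWith.of_le_add_mul _ fun x hx y hy => ?_⟩
  rw [Real.coe_toNNReal _ (by linarith), dist_eq_norm]
  rcases eq_or_ne x y with rfl | hxy
  · simp
  have hd : 0 < ‖x - y‖ := norm_pos_iff.mpr (sub_ne_zero.mpr hxy)
  -- `L + 1` rather than `L`, which may vanish
  set ε := ‖x - y‖ / (L + 1) with hεdef
  have hε : 0 < ε := by positivity
  have key : ∀ δ > 0, w x - w y ≤ quadPenalty ε x y + L ^ 2 * ε / 2 +
      δ * (logPenalty 1 x + logPenalty 1 y + 2 * n) := by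
    intro δ hδ
    have hlog : ∀ x : EuclideanSpace ℝ (Fin n), logPenalty δ x = δ * logPenalty 1 x := fun x => by
      simp [logPenalty, Finset.mul_sum]
    have h := sub_le_quadPenalty_add hn hm hF hε (fun y hy => hfm y (hsub hy))
      (fun x hx y hy => hfL x (hsub hx) y (hsub hy)) (fun _ => logPenalty_nonneg hδ.le)
      (fun _ => logPenalty_nonneg hδ.le) (hw.1.isPenalizedSubsolution ε hδ.le)
      (hw.2.1.isPenalizedSupersolution ε hδ.le)
      (hasCompactSuperlevels_sub_logPenalty hδ hw.continuousOn
        fun x hx => (le_abs_self _).trans (hM x hx))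
      (hasCompactSuperlevels_sub_logPenalty hδ hw.continuousOn.neg
        fun x hx => (neg_le_abs _).trans (hM x hx)) hx hy
    rw [hlog, hlog, ← hL] at h
    linarith
  have hlim : Tendsto (fun δ : ℝ => quadPenalty ε x y + L ^ 2 * ε / 2 +
      δ * (logPenalty 1 x + logPenalty 1 y + 2 * n)) (𝓝[>] 0)
      (𝓝 (quadPenalty ε x y + L ^ 2 * ε / 2)) := by
    refine tendsto_nhdsWithin_of_tendsto_nhds ?_
    refine Continuous.tendsto' (by fun_prop) _ _ (by simp)
  have h := ge_of_tendsto hlim (eventually_nhdsWithin_of_forall key)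
  have h1 : quadPenalty ε x y = (L + 1) * ‖x - y‖ / 2 := by
    rw [quadPenalty_eq_norm, hεdef]
    field_simp
  have h2 : L ^ 2 * ε ≤ (L + 1) * ‖x - y‖ := by
    have : L ^ 2 * ε ≤ (L + 1) ^ 2 * ε := by gcongr; linarith
    have h3 : (L + 1) ^ 2 * ε = (L + 1) * ‖x - y‖ := by rw [hεdef]; field_simp
    linarith
  linarith

/-- Both inequalities between `w` and `w_h`, before `x` is sent to `y` and with `ε = √h`. -/
theorem abs_sub_scheme_le_quadPenalty_add {n : ℕ} (hn : 1 ≤ n)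
    {f w u : EuclideanSpace ℝ (Fin n) → ℝ} (hw : IsBoundedViscositySolution f w) {m F h : ℝ}
    (hm : 0 < m) (hF : 0 ≤ F) (hfm : ∀ x ∈ closedCube n, m ≤ f x)
    (hfL : ∀ x ∈ closedCube n, ∀ y ∈ closedCube n, f x - f y ≤ F * ‖x - y‖)
    (hh : 0 < h) (hu : IsMaximalSchemeSolution h f u) {x y : EuclideanSpace ℝ (Fin n)}
    (hx : x ∈ halfOpenCube n) (hy : y ∈ cubeGrid n h) :
    |w x - u y| ≤ quadPenalty (√h) x y + (n / 2 + (F / min m 1) ^ 2 / 2) * √h := by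
  have hsub := halfOpenCube_subset_closedCube n
  have hε : 0 < √h := Real.sqrt_pos.mpr hh
  have he : h / (2 * √h) = √h / 2 := by
    rw [div_eq_div_iff (by positivity) two_ne_zero]
    linarith [Real.mul_self_sqrt hh.le]
  obtain ⟨M, hM⟩ := hw.2.2
  have hsymm : quadPenalty (√h) y x = quadPenalty (√h) x y :=
    Finset.sum_congr rfl fun i _ => by ring
  have hfin := cubeGrid_finite n hh
  have key : ∀ δ > 0, |w x - u y| ≤ quadPenalty (√h) x y +
      (n / 2 + (F / min m 1) ^ 2 / 2) * √h + δ * (logPenalty 1 x + n) := by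
    intro δ hδ
    have hlog : logPenalty δ x = δ * logPenalty 1 x := by simp [logPenalty, Finset.mul_sum]
    have h1 := sub_le_quadPenalty_add hn hm hF hε (fun y hy => hfm y hy.1)
      (fun x hx y hy => hfL x (hsub hx) y hy.1) (fun _ => logPenalty_nonneg hδ.le)
      (fun _ _ => le_rfl) (hw.1.isPenalizedSubsolution _ hδ.le)
      (hu.isPenalizedSupersolution hh hε)
      (hasCompactSuperlevels_sub_logPenalty hδ hw.continuousOn
        fun x hx => (le_abs_self _).trans (hM x hx))
      (hasCompactSuperlevels_of_finite hfin _) hx hy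
    have h2 := sub_le_quadPenalty_add hn hm hF hε (fun y hy => hfm y (hsub hy))
      (fun x hx y hy => hfL x hx.1 y (hsub hy)) (fun _ _ => le_rfl)
      (fun _ => logPenalty_nonneg hδ.le) (hu.isPenalizedSubsolution hh hε)
      (hw.2.1.isPenalizedSupersolution _ hδ.le) (hasCompactSuperlevels_of_finite hfin _)
      (hasCompactSuperlevels_sub_logPenalty hδ hw.continuousOn.neg
        fun x hx => (neg_le_abs _).trans (hM x hx)) hy hx
    rw [hlog, he] at h1 h2
    rw [hsymm] at h2
    rw [abs_le]
    constructor <;> linarith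
  have hlim : Tendsto (fun δ : ℝ => quadPenalty (√h) x y +
      (n / 2 + (F / min m 1) ^ 2 / 2) * √h + δ * (logPenalty 1 x + n)) (𝓝[>] 0)
      (𝓝 (quadPenalty (√h) x y + (n / 2 + (F / min m 1) ^ 2 / 2) * √h)) := by
    refine tendsto_nhdsWithin_of_tendsto_nhds ?_
    refine Continuous.tendsto' (by fun_prop) _ _ (by simp)
  exact ge_of_tendsto hlim (eventually_nhdsWithin_of_forall key)

theorem theorem1p2 (n : ℕ) (hn : 1 ≤ n) :
    ∃ C : ℝ → ℝ → ℝ,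
      ∀ f : EuclideanSpace ℝ (Fin n) → ℝ,
        (∃ K : NNReal, LipschitzOnWith K f (closedCube n)) →
        (∀ x ∈ closedCube n, 0 < f x) →
        ∀ w : EuclideanSpace ℝ (Fin n) → ℝ, IsMaximalBoundedViscositySolution f w →
          ∃ W : EuclideanSpace ℝ (Fin n) → ℝ,
            ContinuousOn W (closedCube n) ∧ Set.EqOn W w (halfOpenCube n) ∧
            ∀ h : ℝ, 0 < h →
              ∀ wh : EuclideanSpace ℝ (Fin n) → ℝ, IsMaximalSchemeSolution h f wh →
                ∀ x ∈ cubeGrid n h,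
                  |W x - wh x| ≤ C (lipSeminorm f) (sInf (f '' closedCube n)) * √h := by
  -- `F / min m 1` stands in for the Lipschitz constant of `f ^ (1 / n)`
  refine ⟨fun F m => n / 2 + (F / min m 1) ^ 2 / 2, fun f ⟨K, hf⟩ hpos w hw => ?_⟩
  have hm := sInf_image_closedCube_pos hf.continuousOn hpos
  have hfm : ∀ x ∈ closedCube n, sInf (f '' closedCube n) ≤ f x := fun x hx =>
    csInf_le ⟨0, by rintro _ ⟨z, hz, rfl⟩; exact (hpos z hz).le⟩ ⟨x, hx, rfl⟩
  have hfL : ∀ x ∈ closedCube n, ∀ y ∈ closedCube n, f x - f y ≤ lipSeminorm f * ‖x - y‖ :=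
    fun x hx y hy => sub_le_lipSeminorm_mul hf hx hy
  have hF := lipSeminorm_nonneg f
  -- `w` is Lipschitz up to the faces `xᵢ = 0`, so it extends; the estimate on the half-open cube
  -- passes to a grid point `y` by letting `x → y`, where the quadratic penalty vanishes
  obtain ⟨K', hK'⟩ := hw.1.lipschitzOnWith hn hm hF hfm hfL
  obtain ⟨W, hW, hWw⟩ := hK'.extend_real
  refine ⟨W, hW.continuous.continuousOn, hWw.symm, fun h hh wh hwh y hy => ?_⟩
  have hWc : Continuous W := hW.continuous
  have hq : Continuous fun x => quadPenalty (√h) x y :=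
    (continuous_quadPenalty (√h)).comp (by fun_prop : Continuous fun x => (x, y))
  have hclosed : IsClosed {x | |W x - wh y| ≤ quadPenalty (√h) x y +
      (n / 2 + (lipSeminorm f / min (sInf (f '' closedCube n)) 1) ^ 2 / 2) * √h} :=
    isClosed_le (by fun_prop) (hq.add continuous_const)
  have hincl := closure_minimal (fun x hx => by
    rw [mem_ofPred_eq, ← hWw hx]
    exact abs_sub_scheme_le_quadPenalty_add hn hw.1 hm hF hfm hfL hh hwh hx hy) hclosed
  have h := hincl (closedCube_subset_closure_halfOpenCube n hy.1)
  simpa [quadPenalty] using h
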